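/- For an integer $n\ge 0$ let $K_n$ be the complete graph on $n$ vertices. For a finite graph $G=(V,E)$, let its flow polynomial $F_G$ be the characteristic polynomial of the dual of the graphic matroid of $G$, that is, $F_G(x)=\sum_{A\subseteq E}(-1)^{|A|}x^{r^*(E)-r^*(A)}$, where $r^*(A)=r(E\setminus A)+|A|-r(E)$, $r(A)=|V|-c(A)$, and $c(A)$ is the number of connected components of the graph $(V,A)$. For real $x$ put $$S_n(z)=\sum_{i=0}^{n}\frac{z^i}{i!}(1-x)^{i(i-1)/2}.$$ Then for every $n\ge 0$ and every real $x\neq 0$ the function $z\mapsto S_n(z)^x$ (a real power of a function that is positive near $z=0$) is $n$ times continuously differentiable at $z=0$, and $$F_{K_n}(x)=\frac{(-1)^{n(n-1)/2}}{x^n}\left.\frac{\partial^n}{\partial z^n}\Bigl[S_n(z)^x\Bigr]\right|_{z=0}.$$ -/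

import Mathlib

open Polynomial

/-- A matroid on the finite ground set `E`, given by its rank function. -/
structure RankMatroid (E : Type*) [Fintype E] [DecidableEq E] where
  /-- the rank function -/
  r : Finset E → ℕ
  r_le_card : ∀ A, r A ≤ A.card
  r_mono : ∀ A B, A ⊆ B → r A ≤ r B
  r_submod : ∀ A B, r (A ∪ B) + r (A ∩ B) ≤ r A + r B

namespace RankMatroid

variable {E : Type*} [Fintype E] [DecidableEq E]

theorem r_univ_le (M : RankMatroid E) (A : Finset E) :
    M.r Finset.univ ≤ M.r Aᶜ + A.card := by
  have h := M.r_submod Aᶜ A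
  have h' := M.r_le_card A
  rw [Finset.union_comm, Finset.union_compl] at h
  omega

theorem r_union_le (M : RankMatroid E) (A B : Finset E) :
    M.r (A ∪ B) ≤ M.r A + B.card := by
  have h := M.r_submod A B
  have h' := M.r_le_card B
  omega

/-- The dual matroid, `r*(A) = r(E - A) + |A| - r(E)`. The subtraction of natural numbers
does not truncate, by `r_univ_le`. -/
def dual (M : RankMatroid E) : RankMatroid E where
  r A := M.r Aᶜ + A.card - M.r Finset.univ
  r_le_card A := by
    have := M.r_mono Aᶜ Finset.univ (Finset.subset_univ _)
    omega
  r_mono A B h := by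
    have h1 : Aᶜ ⊆ Bᶜ ∪ (B \ A) := by
      intro e he
      by_cases hB : e ∈ B <;> simp_all
    have h2 := (M.r_mono _ _ h1).trans (M.r_union_le _ _)
    have h3 := Finset.card_sdiff_add_card_eq_card h
    omega
  r_submod A B := by
    have h1 := M.r_submod Aᶜ Bᶜ
    have h2 := Finset.card_union_add_card_inter A B
    have hA := M.r_univ_le A
    have hB := M.r_univ_le B
    have hI := M.r_univ_le (A ∩ B)
    have hU := M.r_univ_le (A ∪ B)
    rw [← Finset.compl_inter, ← Finset.compl_union] at h1
    omega

/-- The characteristic polynomial `χ_M(x) = ∑_{A ⊆ E} (-1)^|A| x^(r(E) - r(A))`. -/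
noncomputable def charPoly (M : RankMatroid E) : ℤ[X] :=
  ∑ A : Finset E, (-1) ^ A.card * X ^ (M.r Finset.univ - M.r A)

end RankMatroid

namespace SimpleGraph

variable {V : Type*}

/-- The spanning subgraph `(V, A)` of `G` with edge set `A`. -/
def edgeSubgraph (G : SimpleGraph V) (A : Finset G.edgeSet) : SimpleGraph V :=
  SimpleGraph.fromEdgeSet (Subtype.val '' (A : Set G.edgeSet))

/-- The number of connected components of the spanning subgraph `(V, A)`. -/
noncomputable def numComponents (G : SimpleGraph V) (A : Finset G.edgeSet) : ℕ :=
  Nat.card (G.edgeSubgraph A).ConnectedComponent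

/-- The real functions on the vertices which are constant along every edge of `A`. -/
def edgeConst (G : SimpleGraph V) (A : Finset G.edgeSet) : Submodule ℝ (V → ℝ) where
  carrier := {f | ∀ u v, (G.edgeSubgraph A).Adj u v → f u = f v}
  add_mem' {f g} hf hg u v h := by simp [hf u v h, hg u v h]
  zero_mem' u v _ := rfl
  smul_mem' c f hf u v h := by simp [hf u v h]

theorem mem_edgeConst (G : SimpleGraph V) (A : Finset G.edgeSet) (f : V → ℝ) :
    f ∈ G.edgeConst A ↔ ∀ u v, (G.edgeSubgraph A).Adj u v → f u = f v := Iff.rfl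

theorem edgeSubgraph_adj (G : SimpleGraph V) (A : Finset G.edgeSet) (u v : V) :
    (G.edgeSubgraph A).Adj u v ↔ ∃ h : s(u, v) ∈ G.edgeSet, ⟨s(u, v), h⟩ ∈ A := by
  simp only [edgeSubgraph, fromEdgeSet_adj, Set.mem_image, Finset.mem_coe, Subtype.exists,
    exists_and_right, exists_eq_right]
  constructor
  · exact fun h => h.1
  · rintro ⟨h, hA⟩
    exact ⟨⟨h, hA⟩, G.ne_of_adj h⟩

theorem edgeConst_anti (G : SimpleGraph V) {A B : Finset G.edgeSet} (h : A ⊆ B) :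
    G.edgeConst B ≤ G.edgeConst A := by
  intro f hf u v huv
  obtain ⟨h1, h2⟩ := (G.edgeSubgraph_adj A u v).1 huv
  exact hf u v ((G.edgeSubgraph_adj B u v).2 ⟨h1, h h2⟩)

variable [Fintype V]

theorem numComponents_eq_finrank (G : SimpleGraph V) (A : Finset G.edgeSet) :
    G.numComponents A = Module.finrank ℝ (G.edgeConst A) := by
  classical
  have h : G.edgeConst A = LinearMap.ker (Matrix.toLin' ((G.edgeSubgraph A).lapMatrix ℝ)) := by
    ext f
    rw [LinearMap.mem_ker, Matrix.toLin'_apply, lapMatrix_mulVec_eq_zero_iff_forall_adj]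
    rfl
  rw [h, ← card_connectedComponent_eq_finrank_ker_toLin'_lapMatrix, numComponents,
    Nat.card_eq_fintype_card]

theorem numComponents_le (G : SimpleGraph V) (A : Finset G.edgeSet) :
    G.numComponents A ≤ Fintype.card V := by
  rw [numComponents_eq_finrank]
  simpa using (G.edgeConst A).finrank_le

theorem numComponents_anti (G : SimpleGraph V) {A B : Finset G.edgeSet} (h : A ⊆ B) :
    G.numComponents B ≤ G.numComponents A := by
  simp only [numComponents_eq_finrank]
  exact Submodule.finrank_mono (G.edgeConst_anti h)

theorem card_le_numComponents_singleton (G : SimpleGraph V) (e : G.edgeSet) :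
    Fintype.card V ≤ G.numComponents {e} + 1 := by
  rw [numComponents_eq_finrank]
  obtain ⟨e, he⟩ := e
  induction e with | _ a b =>
  let φ : (V → ℝ) →ₗ[ℝ] ℝ :=
    LinearMap.proj (R := ℝ) (φ := fun _ : V => ℝ) a - LinearMap.proj b
  have h1 : LinearMap.ker φ ≤ G.edgeConst {⟨s(a, b), he⟩} := by
    intro f hf u v huv
    have hf' : f a = f b := by simpa [φ, sub_eq_zero] using hf
    obtain ⟨h, h'⟩ := (G.edgeSubgraph_adj _ u v).1 huv
    simp only [Finset.mem_singleton, Subtype.mk.injEq, Sym2.eq_iff] at h'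
    rcases h' with ⟨rfl, rfl⟩ | ⟨rfl, rfl⟩
    · exact hf'
    · exact hf'.symm
  have h2 := Submodule.finrank_mono h1
  have h3 := φ.finrank_range_add_finrank_ker
  have h4 := (LinearMap.range φ).finrank_le
  simp only [Module.finrank_fintype_fun_eq_card, Module.finrank_self] at h3 h4
  omega

variable [DecidableEq V]

theorem numComponents_supermod (G : SimpleGraph V) (A B : Finset G.edgeSet) :
    G.numComponents A + G.numComponents B ≤
      G.numComponents (A ∪ B) + G.numComponents (A ∩ B) := by
  simp only [numComponents_eq_finrank]
  have h1 : G.edgeConst (A ∪ B) = G.edgeConst A ⊓ G.edgeConst B := by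
    apply le_antisymm
    · exact le_inf (G.edgeConst_anti Finset.subset_union_left)
        (G.edgeConst_anti Finset.subset_union_right)
    · rintro f ⟨hA, hB⟩ u v huv
      obtain ⟨h, h'⟩ := (G.edgeSubgraph_adj _ u v).1 huv
      rcases Finset.mem_union.1 h' with h' | h'
      · exact hA u v ((G.edgeSubgraph_adj _ u v).2 ⟨h, h'⟩)
      · exact hB u v ((G.edgeSubgraph_adj _ u v).2 ⟨h, h'⟩)
  have h2 : G.edgeConst A ⊔ G.edgeConst B ≤ G.edgeConst (A ∩ B) :=
    sup_le (G.edgeConst_anti Finset.inter_subset_left)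
      (G.edgeConst_anti Finset.inter_subset_right)
  have h3 := Submodule.finrank_mono h2
  have h4 := Submodule.finrank_sup_add_finrank_inf_eq (G.edgeConst A) (G.edgeConst B)
  rw [h1]
  omega

theorem card_le_numComponents_add_card (G : SimpleGraph V) (A : Finset G.edgeSet) :
    Fintype.card V ≤ G.numComponents A + A.card := by
  induction A using Finset.induction_on with
  | empty =>
    rw [numComponents_eq_finrank]
    have : G.edgeConst ∅ = ⊤ := by
      rw [eq_top_iff]
      intro f _ u v huv
      obtain ⟨_, h⟩ := (G.edgeSubgraph_adj _ u v).1 huv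
      simp at h
    rw [this, finrank_top]
    simp
  | insert e A he ih =>
    have h1 := G.numComponents_supermod {e} A
    have h2 := G.card_le_numComponents_singleton e
    have h3 := G.numComponents_le ({e} ∩ A)
    rw [← Finset.insert_eq] at h1
    rw [Finset.card_insert_of_notMem he]
    omega

/-- The graphic matroid of `G`, on the edges of `G`: the rank of a set `A` of edges is the
number of vertices minus the number of connected components of the graph formed by `A`.
(Vertices that are not incident with `A` may be counted or not: each contributes one vertex
and one component.) -/
noncomputable def graphicMatroid (G : SimpleGraph V) [DecidableRel G.Adj] :
    RankMatroid G.edgeSet where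
  r A := Fintype.card V - G.numComponents A
  r_le_card A := by
    have := G.card_le_numComponents_add_card A
    omega
  r_mono A B h := by
    have := G.numComponents_anti h
    omega
  r_submod A B := by
    have h := G.numComponents_supermod A B
    have hA := G.numComponents_le A
    have hB := G.numComponents_le B
    have hI := G.numComponents_le (A ∩ B)
    have hU := G.numComponents_le (A ∪ B)
    omega

/-- The flow polynomial: the characteristic polynomial of the dual of the graphic matroid. -/
noncomputable def flowPolynomial (G : SimpleGraph V) [DecidableRel G.Adj] : ℤ[X] :=
  G.graphicMatroid.dual.charPoly

end SimpleGraph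

/-! Complementing edge sets turns the flow polynomial into `(-1)^|E| x^(-|V|) ∑_A (-x)^|A| x^c(A)`.
The two roles of `x` are then separated: fix the weight `-x` and replace the base of `x^c(A)` by a
variable `y`. At `y = k` natural, `k^c(A)` counts the `k`-colourings constant along `A`, so the sum
becomes `∑_f (1 - x)^(monochromatic edges of f)` (`sum_pow_numComponents`). For `K_n` the exponent
depends only on the sizes of the colour classes, and the exponential formula
(`factorial_mul_coeff_pow`) gives the `n`-th derivative of `S_n^k` at `0`. Since `S_n(0) = 1`, that
derivative is polynomial in the exponent (`exists_poly_iteratedDeriv_rpow_mul`), so agreement at all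
naturals extends to `y = x`. -/

/-- Grouping the maps `Fin n → κ` by the sizes of their fibres. -/
theorem sum_prod_card_fiber {κ : Type*} [Fintype κ] [DecidableEq κ] (n : ℕ) (a : ℕ → ℝ) :
    ∑ f : Fin n → κ, ∏ c, a (Finset.univ.filter (fun v => f v = c)).card =
      ∑ g ∈ Finset.piAntidiag (Finset.univ : Finset κ) n,
        (Nat.multinomial Finset.univ g : ℝ) * ∏ c, a (g c) := by
  -- `(∑ X_c)^n` expands both over words and over multinomial exponents; this linear functional
  -- replaces each `X_c^m` by `a m` in both expansions.
  let L : MvPolynomial κ ℝ →ₗ[ℝ] ℝ :=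
    (MvPolynomial.basisMonomials κ ℝ).constr ℝ (fun m => ∏ c, a (m c))
  have hL (g : κ → ℕ) : L (∏ c, MvPolynomial.X c ^ g c) = ∏ c, a (g c) := by
    have h : (∏ c, MvPolynomial.X c ^ g c : MvPolynomial κ ℝ) =
        MvPolynomial.basisMonomials κ ℝ (Finsupp.equivFunOnFinite.symm g) := by
      rw [MvPolynomial.coe_basisMonomials]
      simp [MvPolynomial.monomial_eq, Finsupp.prod_fintype]
    rw [h, Module.Basis.constr_basis]
    simp
  have h1 : (∑ c : κ, (MvPolynomial.X c : MvPolynomial κ ℝ)) ^ n =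
      ∑ f : Fin n → κ, ∏ c, MvPolynomial.X c ^ (Finset.univ.filter (fun v => f v = c)).card := by
    rw [Fintype.sum_pow]
    refine Finset.sum_congr rfl fun f _ => ?_
    rw [← Finset.prod_fiberwise' Finset.univ f]
    simp
  have h2 := congrArg L (h1.symm.trans (Finset.sum_pow_eq_sum_piAntidiag _ _ _))
  simp only [← nsmul_eq_mul, map_sum, map_nsmul, hL] at h2
  simpa only [nsmul_eq_mul] using h2

/-- Exponential formula: a product of `k` exponential generating functions distributes `n` labels
into `k` classes. Truncating at degree `n` loses nothing, since no class exceeds `n`. -/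
theorem factorial_mul_coeff_pow (n k : ℕ) (a : ℕ → ℝ) :
    (n.factorial : ℝ) *
        ((∑ i ∈ Finset.range (n + 1), C (a i / (i.factorial : ℝ)) * X ^ i) ^ k).coeff n =
      ∑ f : Fin n → Fin k, ∏ c, a (Finset.univ.filter (fun v => f v = c)).card := by
  have h : (Fintype.piFinset fun _ : Fin k => Finset.range (n + 1)).filter
      (fun g => n = ∑ c, g c) = Finset.piAntidiag Finset.univ n := by
    ext g
    simp only [Finset.mem_filter, Fintype.mem_piFinset, Finset.mem_range, Finset.mem_piAntidiag,
      Finset.mem_univ, implies_true, and_true]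
    constructor
    · exact fun h => h.2.symm
    · intro h
      refine ⟨fun c => ?_, h.symm⟩
      exact Nat.lt_succ_of_le
        (h ▸ Finset.single_le_sum (f := g) (fun _ _ => Nat.zero_le _) (Finset.mem_univ c))
  have hp : (∑ i ∈ Finset.range (n + 1), C (a i / (i.factorial : ℝ)) * X ^ i) ^ k =
      ∑ g ∈ Fintype.piFinset fun _ : Fin k => Finset.range (n + 1),
        C (∏ c, a (g c) / ((g c).factorial : ℝ)) * X ^ (∑ c, g c) := by
    have := Finset.prod_univ_sum (fun _ : Fin k => Finset.range (n + 1))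
      (fun _ i => C (a i / (i.factorial : ℝ)) * X ^ i)
    rw [Finset.prod_const, Finset.card_univ, Fintype.card_fin] at this
    rw [this]
    simp only [Finset.prod_mul_distrib, Finset.prod_pow_eq_pow_sum, map_prod]
  rw [hp, sum_prod_card_fiber, finsetSum_coeff]
  simp only [coeff_C_mul, coeff_X_pow, mul_ite, mul_one, mul_zero]
  rw [← Finset.sum_filter, h, Finset.mul_sum]
  refine Finset.sum_congr rfl fun g hg => ?_
  have hs := Nat.multinomial_spec (Finset.univ : Finset (Fin k)) g
  rw [(Finset.mem_piAntidiag.1 hg).1] at hs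
  rw [← hs, Finset.prod_div_distrib]
  have : (∏ c, ((g c).factorial : ℝ)) ≠ 0 :=
    Finset.prod_ne_zero_iff.2 fun c _ => by exact_mod_cast (g c).factorial_ne_zero
  push_cast
  field_simp

theorem iteratedDeriv_eval_zero (p : ℝ[X]) (n : ℕ) :
    iteratedDeriv n (fun z => p.eval z) 0 = n.factorial * p.coeff n := by
  have h (m : ℕ) : deriv^[m] (fun z => p.eval z) = fun z => (derivative^[m] p).eval z := by
    induction m with
    | zero => rfl
    | succ m ih =>
      rw [Function.iterate_succ_apply', ih, Function.iterate_succ_apply']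
      ext z
      exact Polynomial.deriv _
  rw [iteratedDeriv_eq_iterate, h]
  beta_reduce
  rw [← coeff_zero_eq_eval_zero, coeff_iterate_derivative]
  simp [Nat.descFactorial_self]

/-- The derivatives of a real power at a point where the base is `1` are polynomial in the
exponent. -/
theorem exists_poly_iteratedDeriv_rpow_mul {S : ℝ → ℝ} {t : ℝ} (hS : AnalyticAt ℝ S t)
    (h1 : S t = 1) (n : ℕ) :
    ∀ g : ℝ → ℝ, AnalyticAt ℝ g t →
      ∃ P : ℝ[X], ∀ y : ℝ, iteratedDeriv n (fun z => S z ^ y * g z) t = P.eval y := by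
  induction n with
  | zero => exact fun g _ => ⟨C (g t), fun y => by simp [h1]⟩
  | succ n ih =>
    intro g hg
    have hS0 : S t ≠ 0 := by simp [h1]
    -- One derivative of `S^y g` is `y S^y (S' g / S) + S^y g'`: two terms of the same shape, which
    -- is why `g` is quantified inside the induction.
    obtain ⟨P, hP⟩ := ih _ ((hS.deriv.mul hg).div hS hS0)
    obtain ⟨Q, hQ⟩ := ih _ hg.deriv
    refine ⟨X * P + Q, fun y => ?_⟩
    have hne : ∀ᶠ z in nhds t, S z ≠ 0 := hS.continuousAt.eventually_ne hS0
    have hderiv : deriv (fun z => S z ^ y * g z) =ᶠ[nhds t]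
        ((fun z => y * (S z ^ y * ((deriv S * g) / S) z)) + fun z => S z ^ y * deriv g z) := by
      filter_upwards [hne, hS.eventually_analyticAt, hg.eventually_analyticAt] with z hz hSz hgz
      have h2 := (hSz.differentiableAt.hasDerivAt.rpow_const (p := y) (Or.inl hz)).mul
        hgz.differentiableAt.hasDerivAt
      rw [show (fun z => S z ^ y * g z) = (fun z => S z ^ y) * g from rfl, h2.deriv]
      simp only [Pi.add_apply, Pi.mul_apply, Pi.div_apply]
      rw [Real.rpow_sub_one hz]
      ring
    have hc (f : ℝ → ℝ) (hf : AnalyticAt ℝ f t) :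
        ContDiffAt ℝ n (fun z => S z ^ y * f z) t :=
      (hS.contDiffAt.rpow_const_of_ne hS0).mul hf.contDiffAt
    rw [iteratedDeriv_succ', hderiv.iteratedDeriv_eq, iteratedDeriv_add
      (contDiffAt_const.mul (hc _ ((hS.deriv.mul hg).div hS hS0))) (hc _ hg.deriv),
      iteratedDeriv_const_mul_field, hP, hQ]
    simp

namespace SimpleGraph

/-- The dual corank of `Aᶜ` is the nullity `|A| - r(A) = |A| + c(A) - |V|`. -/
theorem aeval_flowPolynomial {V : Type*} [Fintype V] [DecidableEq V] (G : SimpleGraph V) [DecidableRel G.Adj] (x : ℝ) (hx : x ≠ 0) :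
    aeval x G.flowPolynomial = (-1) ^ Fintype.card G.edgeSet / x ^ Fintype.card V *
      ∑ A : Finset G.edgeSet, (-x) ^ A.card * x ^ G.numComponents A := by
  rw [flowPolynomial, RankMatroid.charPoly, map_sum, Finset.mul_sum,
    ← Equiv.sum_comp (Function.Involutive.toPerm _ (compl_involutive (α := Finset G.edgeSet)))]
  refine Finset.sum_congr rfl fun A _ => ?_
  simp only [Function.Involutive.coe_toPerm, map_mul, map_pow, map_neg, map_one, aeval_X]
  have h0 : G.graphicMatroid.r ∅ = 0 := by
    have := G.graphicMatroid.r_le_card ∅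
    simpa using this
  have hA := G.graphicMatroid.r_univ_le Aᶜ
  have hle := G.graphicMatroid.r_le_card A
  have hmono := G.graphicMatroid.r_mono A _ (Finset.subset_univ A)
  have hu := G.graphicMatroid.r_le_card Finset.univ
  have hcard := Finset.card_compl_add_card A
  have hexp : G.graphicMatroid.dual.r Finset.univ - G.graphicMatroid.dual.r Aᶜ =
      A.card - G.graphicMatroid.r A := by
    simp only [RankMatroid.dual, Finset.compl_univ, compl_compl, h0, Finset.card_univ] at *
    omega
  have hr : G.graphicMatroid.r A = Fintype.card V - G.numComponents A := rfl
  have hc := G.numComponents_le A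
  have he : A.card + G.numComponents A = (A.card - G.graphicMatroid.r A) + Fintype.card V := by
    omega
  have hs : (-1 : ℝ) ^ Aᶜ.card = (-1) ^ Fintype.card G.edgeSet * (-1) ^ A.card := by
    rw [← hcard, pow_add, mul_assoc, ← mul_pow]
    simp
  rw [hexp, hs, neg_pow x, mul_assoc _ (x ^ _), ← pow_add x, he, pow_add x]
  field_simp

/-- The maps that are constant on the edges of `A` are the maps on the components of `A`. -/
theorem pow_numComponents {V : Type*} [Fintype V] (G : SimpleGraph V) (A : Finset G.edgeSet) (k : ℕ) :
    k ^ G.numComponents A =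
      Nat.card {f : V → Fin k // ∀ u v, (G.edgeSubgraph A).Adj u v → f u = f v} := by
  classical
  have e : ((G.edgeSubgraph A).ConnectedComponent → Fin k) ≃
      {f : V → Fin k // ∀ u v, (G.edgeSubgraph A).Adj u v → f u = f v} :=
    { toFun := fun φ => ⟨fun v => φ (connectedComponentMk _ v), fun u v h =>
        congrArg φ (ConnectedComponent.connectedComponentMk_eq_of_adj h)⟩
      invFun := fun f => Quot.lift f.1 fun u v h => by
        obtain ⟨p⟩ := h
        induction p with
        | nil => rfl
        | cons h _ ih => exact (f.2 _ _ h).trans ih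
      left_inv := fun φ => by
        ext c
        induction c using ConnectedComponent.ind
        rfl
      right_inv := fun f => rfl }
  rw [← Nat.card_congr e, Nat.card_fun, Nat.card_fin, numComponents]

/-- `e` is monochromatic under the colouring `f`. -/
def IsMono {V κ : Type*} (f : V → κ) (e : Sym2 V) : Prop :=
  (e.map f).IsDiag

theorem isMono_mk {V κ : Type*} (f : V → κ) (u v : V) : IsMono f s(u, v) ↔ f u = f v := by
  simp [IsMono]

-- Fortuin–Kasteleyn expansion: after exchanging the sums, a fixed `f` admits exactly the subsets
-- `A` of its monochromatic edges, each such edge contributing a factor `1 + w`.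
open Classical in
theorem sum_pow_numComponents {V : Type*} [Fintype V] [DecidableEq V] (G : SimpleGraph V) [DecidableRel G.Adj] (w : ℝ) (k : ℕ) :
    ∑ A : Finset G.edgeSet, w ^ A.card * (k : ℝ) ^ G.numComponents A =
      ∑ f : V → Fin k, (1 + w) ^ (G.edgeFinset.filter (IsMono f)).card := by
  have h1 (A : Finset G.edgeSet) : w ^ A.card * (k : ℝ) ^ G.numComponents A =
      ∑ f : V → Fin k, ∏ e ∈ A, if IsMono f e.1 then w else 0 := by
    rw [← Nat.cast_pow, pow_numComponents, Nat.card_eq_fintype_card, Fintype.card_subtype,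
      Finset.card_filter, Nat.cast_sum, Finset.mul_sum]
    refine Finset.sum_congr rfl fun f _ => ?_
    have h : (∀ u v, (G.edgeSubgraph A).Adj u v → f u = f v) ↔ ∀ e ∈ A, IsMono f e.1 := by
      constructor
      · rintro h ⟨e, he⟩ hA
        induction e with | _ u v =>
        exact (isMono_mk f u v).2 (h u v ((G.edgeSubgraph_adj A u v).2 ⟨he, hA⟩))
      · intro h u v huv
        obtain ⟨he, hA⟩ := (G.edgeSubgraph_adj A u v).1 huv
        exact (isMono_mk f u v).1 (h _ hA)
    simp only [h, Finset.prod_ite_zero]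
    split_ifs <;> simp
  simp only [h1]
  rw [Finset.sum_comm]
  refine Finset.sum_congr rfl fun f _ => ?_
  rw [← Finset.powerset_univ, ← Finset.prod_one_add,
    ← Finset.prod_subtype G.edgeFinset (fun _ => mem_edgeFinset)
      (fun e => 1 + if IsMono f e then w else 0), ← Finset.prod_const, Finset.prod_filter]
  refine Finset.prod_congr rfl fun e _ => ?_
  split_ifs <;> simp

open Classical in
theorem card_isMono_completeGraph {V : Type*} [Fintype V] [DecidableEq V] {κ : Type*} [Fintype κ] (f : V → κ)
    [Fintype (completeGraph V).edgeSet] :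
    ((completeGraph V).edgeFinset.filter (IsMono f)).card =
      ∑ c, (Finset.univ.filter (fun v => f v = c)).card.choose 2 := by
  have h : (completeGraph V).edgeFinset.filter (IsMono f) =
      Finset.univ.biUnion fun c =>
        (Finset.univ.filter (fun v => f v = c)).offDiag.image Sym2.mk.uncurry := by
    ext e
    induction e with | _ u v =>
    simp only [Finset.mem_filter, mem_edgeFinset, mem_edgeSet, completeGraph, top_adj, isMono_mk,
      Finset.mem_biUnion, Finset.mem_univ, true_and, Finset.mem_image, Finset.mem_offDiag,
      Prod.exists, Function.uncurry_apply_pair, Sym2.eq_iff]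
    constructor
    · rintro ⟨hne, hf⟩
      exact ⟨f v, u, v, ⟨hf, rfl, hne⟩, Or.inl ⟨rfl, rfl⟩⟩
    · rintro ⟨c, a, b, ⟨ha, hb, hab⟩, ⟨rfl, rfl⟩ | ⟨rfl, rfl⟩⟩
      · exact ⟨hab, ha.trans hb.symm⟩
      · exact ⟨hab.symm, hb.trans ha.symm⟩
  rw [h, Finset.card_biUnion]
  · simp only [Sym2.card_image_offDiag]
  · intro c _ d _ hcd
    refine Finset.disjoint_left.2 fun e hc hd => hcd ?_
    simp only [Finset.mem_image, Finset.mem_offDiag, Finset.mem_filter, Finset.mem_univ, true_and,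
      Prod.exists, Function.uncurry_apply_pair] at hc hd
    obtain ⟨a, b, ⟨ha, hb, -⟩, rfl⟩ := hc
    obtain ⟨a', b', ⟨ha', hb', -⟩, h'⟩ := hd
    rcases Sym2.eq_iff.1 h' with ⟨rfl, rfl⟩ | ⟨rfl, rfl⟩
    · exact ha.symm.trans ha'
    · exact hb.symm.trans ha'
end SimpleGraph

theorem corollary4 (n : ℕ) (x : ℝ) (hx : x ≠ 0) :
    ContDiffAt ℝ n (fun z : ℝ =>
      (∑ i ∈ Finset.range (n + 1),
        z ^ i / (i.factorial : ℝ) * (1 - x) ^ (i * (i - 1) / 2)) ^ x) 0 ∧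
    Polynomial.aeval x (SimpleGraph.completeGraph (Fin n)).flowPolynomial =
      (-1) ^ (n * (n - 1) / 2) / x ^ n *
        iteratedDeriv n (fun z : ℝ =>
          (∑ i ∈ Finset.range (n + 1),
            z ^ i / (i.factorial : ℝ) * (1 - x) ^ (i * (i - 1) / 2)) ^ x) 0 := by
  classical
  set p : ℝ[X] := ∑ i ∈ Finset.range (n + 1),
    C ((1 - x) ^ (i * (i - 1) / 2) / (i.factorial : ℝ)) * X ^ i with hp
  have hS (z : ℝ) : ∑ i ∈ Finset.range (n + 1),
      z ^ i / (i.factorial : ℝ) * (1 - x) ^ (i * (i - 1) / 2) = p.eval z := by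
    rw [hp, eval_finsetSum]
    refine Finset.sum_congr rfl fun i _ => ?_
    simp only [eval_mul, eval_C, eval_pow, eval_X]
    ring
  have hp0 : p.eval 0 = 1 := by
    rw [← hS, Finset.sum_range_succ']
    simp
  have han : AnalyticAt ℝ (fun z => p.eval z) 0 :=
    AnalyticOnNhd.eval_polynomial p 0 (Set.mem_univ _)
  simp only [hS]
  refine ⟨han.contDiffAt.rpow_const_of_ne (by simp [hp0]), ?_⟩
  obtain ⟨P, hP⟩ := exists_poly_iteratedDeriv_rpow_mul han hp0 n (fun _ => 1) analyticAt_const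
  simp only [mul_one] at hP
  -- Only the base of `c(A)` becomes the variable; the `x` in the edge weight stays fixed, as does
  -- the `x` inside `S_n`.
  let Q : ℝ[X] := ∑ A : Finset (SimpleGraph.completeGraph (Fin n)).edgeSet,
    C ((-x) ^ A.card) * X ^ (SimpleGraph.completeGraph (Fin n)).numComponents A
  have hQ (y : ℝ) : Q.eval y = ∑ A : Finset (SimpleGraph.completeGraph (Fin n)).edgeSet,
      (-x) ^ A.card * y ^ (SimpleGraph.completeGraph (Fin n)).numComponents A := by
    simp [Q, eval_finsetSum]
  have hnat (k : ℕ) : P.eval (k : ℝ) = Q.eval (k : ℝ) := by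
    rw [← hP, hQ, SimpleGraph.sum_pow_numComponents]
    simp only [Real.rpow_natCast, ← eval_pow]
    rw [iteratedDeriv_eval_zero, factorial_mul_coeff_pow]
    refine Finset.sum_congr rfl fun f _ => ?_
    rw [SimpleGraph.card_isMono_completeGraph, ← Finset.prod_pow_eq_pow_sum, ← sub_eq_add_neg]
    simp only [Nat.choose_two_right]
    congr!
  have hPQ : P = Q := by
    refine eq_of_infinite_eval_eq _ _ ((Set.infinite_range_of_injective
      (Nat.cast_injective (R := ℝ))).mono ?_)
    rintro _ ⟨k, rfl⟩
    exact hnat k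
  have hcard : Fintype.card (SimpleGraph.completeGraph (Fin n)).edgeSet = n * (n - 1) / 2 := by
    have := SimpleGraph.card_edgeFinset_top_eq_card_choose_two (V := Fin n)
    rw [SimpleGraph.edgeFinset_card, Fintype.card_fin, Nat.choose_two_right] at this
    rw [← this]
  rw [hP, hPQ, hQ, SimpleGraph.aeval_flowPolynomial _ x hx, hcard, Fintype.card_fin]
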